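/- **Theorem (Statistical robustness).** Let $X$ be a subset of a separable normed space, $Y\subset\mathbb R$ a closed set and $Z=X\times Y$, with the norm $\|(x,y)\|=\max\{\|x\|,|y|\}$ and its Borel $\sigma$-algebra; let $\mathscr P(Z)$ be the set of Borel probability measures on $Z$. Let $\mathcal H_k$ be a reproducing kernel Hilbert space of real functions on $X$ with kernel $k$ and norm $\|\cdot\|_k$, let $\mathcal F\subset\mathcal H_k$ be a nonempty class of functions with values in $Y$, and let $c:Z\times Y\to\mathbb R$ be a cost function with $c(z,f(x))\ge 0$ for all $f\in\mathcal F$ and $z=(x,y)\in Z$. Assume: 1. for every compact $Z_0\subset Z$ with projection $X_0$ on $X$ and every $\epsilon>0$ there is $\eta>0$ such that $\|k(\cdot,x')-k(\cdot,x)\|_k<\epsilon$ for all $x,x'\in X_0$ with $\|x'-x\|<\eta$; 2. there is $\beta>0$ with $\|f\|_k\le\beta$ for all $f\in\mathcal F$; 3. there is a gauge function $\phi$ (a continuous $\phi:Z\to[0,\infty)$ with $\phi\ge 1$ outside a compact set) such that $\phi(z)\to\infty$ as $\|z\|\to\infty$ and $c(z,f(x))\le\phi(z)$ for all $z=(x,y)\in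 Z$ and $f\in\mathcal F$; 4. $c$ is continuous on $Z\times Y$. Let $p>1$, $\kappa\ge0$ and $\mathcal M^{\phi^p}_{Z,\kappa}=\{P\in\mathscr P(Z):\int_Z\phi^p\,dP\le\kappa\}$. Let $\lambda_N>0$ with $\lambda_N\to0$. For a sample $\vec z^N=(z^1,\dots,z^N)\in Z^N$, $z^i=(x^i,y^i)$, with empirical measure $P_N=\frac1N\sum_{i=1}^N\delta_{z^i}$, let $$\hat\vartheta_N(\vec z^N,\lambda_N)=\vartheta(P_N,\lambda_N)=\inf_{f\in\mathcal F}\Big\{\frac1N\sum_{i=1}^N c(z^i,f(x^i))+\lambda_N\|f\|_k^2\Big\}.$$ Let $\mathsf d_{\mathrm{Prok}}$ be the Prokhorov metric and $\mathsf d_\phi(P,Q)=\mathsf d_{\mathrm{Prok}}(P,Q)+\left|\int_Z\phi\,dP-\int_Z\phi\,dQ\right|$. Then each $\hat\vartheta_N(\cdot,\lambda_N)$ is measurable, and for every $\mathcal M\subset\mathcal M^{\phi^p}_{Z,\kappa}$, every $P\in\mathcal M^{\phi^p}_{Z,\kappa}$ and every $\epsilon>0$ there exist $\delta>0$ and $N_0\in\mathbb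 N$ such that for all $N\ge N_0$ one has $\lambda_N\le\frac{\epsilon}{6\beta^2}$ and, for all $Q\in\mathcal M$ with $\mathsf d_\phi(P,Q)\le\delta$, $$\mathsf d_{\mathrm{Prok}}\left(P^{\otimes N}\circ\hat\vartheta_N(\cdot,\lambda_N)^{-1},\;Q^{\otimes N}\circ\hat\vartheta_N(\cdot,\lambda_N)^{-1}\right)\le\epsilon .$$ -/

import Mathlib

open MeasureTheory Filter Topology
open scoped ENNReal

namespace KernelLearning

/-- A gauge function on `Z`: continuous, non-negative, and at least `1` outside a compact set. -/
structure IsGauge {Z : Type*} [TopologicalSpace Z] (φ : Z → ℝ) : Prop where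
  continuous : Continuous φ
  nonneg : ∀ z, 0 ≤ φ z
  one_le : ∃ K : Set Z, IsCompact K ∧ ∀ z, z ∉ K → 1 ≤ φ z

/-- The class of all probability measures `P` on `Z` with `∫ φ ^ p dP ≤ κ`. -/
def momentClass {Z : Type*} [MeasurableSpace Z] (φ : Z → ℝ) (p κ : ℝ) :
    Set (ProbabilityMeasure Z) :=
  {P | ∫⁻ z, ENNReal.ofReal (φ z ^ p) ∂(P : Measure Z) ≤ ENNReal.ofReal κ}

/-- The metric `d_φ (P, Q) = d_Prok (P, Q) + |∫ φ dP - ∫ φ dQ|`. -/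
noncomputable def dPhi {Z : Type*} [MeasurableSpace Z] [PseudoEMetricSpace Z] (φ : Z → ℝ)
    (P Q : ProbabilityMeasure Z) : ℝ :=
  levyProkhorovDist (P : Measure Z) (Q : Measure Z)
    + |(∫ z, φ z ∂(P : Measure Z)) - ∫ z, φ z ∂(Q : Measure Z)|

/-- The empirical measure `(1 / N) ∑ i, δ_{z i}` of a sample of size `N`. -/
noncomputable def empiricalMeasure {Z : Type*} [MeasurableSpace Z] {N : ℕ} (z : Fin N → Z) :
    Measure Z :=
  (N : ℝ≥0∞)⁻¹ • ∑ i, Measure.dirac (z i)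

/-- The law of the statistic `T` of a sample of size `N` under the product measure `P^{⊗ N}`. -/
noncomputable def sampleLaw {Z : Type*} [MeasurableSpace Z] (P : ProbabilityMeasure Z) {N : ℕ}
    (T : (Fin N → Z) → ℝ) : Measure ℝ :=
  (Measure.pi fun _ : Fin N => (P : Measure Z)).map T

section Learning

variable {E : Type*} {X : Set E} {Y : Set ℝ}
  [MeasurableSpace E]
  {H : Type*} [NormedAddCommGroup H] [InnerProductSpace ℝ H] [RKHS ℝ H X ℝ]

/-- The regularized risk `E_μ [c (z, f x)] + lam * ‖f‖ ^ 2`, where `z = (x, y)`. -/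
noncomputable def regRisk (c : X × Y → ℝ → ℝ) (μ : Measure (X × Y)) (lam : ℝ) (f : H) : ℝ :=
  (∫ z, c z (f z.1) ∂μ) + lam * ‖f‖ ^ 2

/-- The optimal value of the regularized problem over the class `F`. -/
noncomputable def optValue (c : X × Y → ℝ → ℝ) (F : Set H) (μ : Measure (X × Y)) (lam : ℝ) : ℝ :=
  ⨅ f : F, regRisk c μ lam (f : H)

/-- The optimal value of the regularized empirical problem, as a function of the sample. -/
noncomputable def empOptValue (c : X × Y → ℝ → ℝ) (F : Set H) (lam : ℝ) (N : ℕ)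
    (z : Fin N → X × Y) : ℝ :=
  optValue c F (empiricalMeasure z) lam

end Learning

end KernelLearning

namespace KernelLearning

open scoped BoundedContinuousFunction RealInnerProductSpace
open ProbabilityTheory

/-- A pointwise equicontinuous uniformly bounded family of functions on a separable metric space
is controlled by finitely many bounded continuous test functions. -/
lemma exists_finite_test_functions {Z : Type*} [MetricSpace Z] [SecondCountableTopology Z]
    [MeasurableSpace Z] [BorelSpace Z] {ι : Type*} (G : ι → Z → ℝ) (hG : Equicontinuous G)
    {m : ℝ} (hm : 0 ≤ m) (hG0 : ∀ i z, 0 ≤ G i z) (hGm : ∀ i z, G i z ≤ m)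
    (P : Measure Z) [IsProbabilityMeasure P] {ε : ℝ} (hε : 0 < ε) :
    ∃ (S : Set Z) (t : Finset S) (ψ : S → Z →ᵇ ℝ) (η : ℝ), 0 < η ∧
      (∀ i z, 0 ≤ ψ i z) ∧ (∀ i z, ψ i z ≤ 1) ∧
      ∀ (μ : Measure Z) [IsProbabilityMeasure μ],
        (∀ i ∈ t, |∫ z, ψ i z ∂μ - ∫ z, ψ i z ∂P| ≤ η) →
          ∀ j, |∫ z, G j z ∂μ - ∫ z, G j z ∂P| ≤ ε := by
  classical
  have hU : ∀ z : Z, ∃ U : Set Z, IsOpen U ∧ z ∈ U ∧ ∀ w ∈ U, ∀ i, |G i w - G i z| ≤ ε / 4 := by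
    intro z
    have h := Metric.equicontinuousAt_iff_right.1 (hG z) (ε / 4) (by positivity)
    obtain ⟨U, hUs, hUo, hzU⟩ := mem_nhds_iff.1 h
    refine ⟨U, hUo, hzU, fun w hw i => ?_⟩
    have := hUs hw i
    rw [dist_comm, Real.dist_eq] at this
    exact this.le
  choose U hUo hzU hUG using hU
  obtain ⟨S, hSc, hS⟩ := TopologicalSpace.countable_cover_nhds
    (fun z : Z => (hUo z).mem_nhds (hzU z))
  have : Countable S := hSc.to_subtype
  obtain ⟨f, hf⟩ := PartitionOfUnity.exists_isSubordinate (isClosed_univ (X := Z))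
    (fun s : S => U s) (fun s => hUo s) (by
      rw [← hS]
      intro x hx
      obtain ⟨s, hs, hx⟩ := Set.mem_iUnion₂.1 hx
      exact Set.mem_iUnion.2 ⟨⟨s, hs⟩, hx⟩)
  let ψ : S → Z →ᵇ ℝ := fun i => BoundedContinuousFunction.ofNormedAddCommGroup (f i)
    (f i).continuous 1 (fun z => by
      rw [Real.norm_eq_abs, abs_of_nonneg (f.nonneg i z)]; exact f.le_one i z)
  have hψ : ∀ i z, ψ i z = f i z := fun i z => rfl
  have hψ0 : ∀ i z, 0 ≤ ψ i z := fun i z => f.nonneg i z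
  have hψ1 : ∀ i z, ψ i z ≤ 1 := fun i z => f.le_one i z
  have hsum1 : ∀ (t : Finset S) z, ∑ i ∈ t, ψ i z ≤ 1 := by
    intro t z
    have h1 := f.sum_finsupport' (Set.mem_univ z)
      (Finset.subset_union_left (s₁ := f.finsupport z) (s₂ := t))
    rw [← h1]
    exact Finset.sum_le_sum_of_subset_of_nonneg Finset.subset_union_right
      (fun i _ _ => f.nonneg i z)
  have hint : ∀ (μ : Measure Z) [IsProbabilityMeasure μ] i, Integrable (fun z => ψ i z) μ :=
    fun μ _ i => (ψ i).integrable μ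
  have hlim : Tendsto (fun t : Finset S => ∫ z, ∑ i ∈ t, ψ i z ∂P) atTop (𝓝 (∫ _, 1 ∂P)) := by
    refine tendsto_integral_filter_of_dominated_convergence (fun _ => 1) ?_ ?_ ?_ ?_
    · exact Eventually.of_forall fun t =>
        (integrable_finsetSum t fun i _ => hint P i).aestronglyMeasurable
    · refine Eventually.of_forall fun t => Eventually.of_forall fun z => ?_
      rw [Real.norm_eq_abs, abs_of_nonneg (Finset.sum_nonneg fun i _ => hψ0 i z)]
      exact hsum1 t z
    · exact integrable_const _
    · refine Eventually.of_forall fun z => ?_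
      refine tendsto_atTop_of_eventually_const (i₀ := f.finsupport z) fun t ht => ?_
      exact f.sum_finsupport' (Set.mem_univ z) ht
  simp only [integral_const, probReal_univ, smul_eq_mul, mul_one] at hlim
  have hpos : 0 < ε / (8 * (m + 1)) := by positivity
  obtain ⟨t, ht⟩ := (hlim.eventually (lt_mem_nhds (sub_lt_self 1 hpos))).exists
  have hη : 0 < ε / (8 * (m + 1)) / (t.card + 1) := by positivity
  refine ⟨S, t, ψ, ε / (8 * (m + 1)) / (t.card + 1), hη, hψ0, hψ1, ?_⟩
  have hGint : ∀ (μ : Measure Z) [IsProbabilityMeasure μ] j, Integrable (G j) μ := by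
    intro μ _ j
    refine Integrable.of_bound (hG.continuous j).aestronglyMeasurable m
      (Eventually.of_forall fun z => ?_)
    rw [Real.norm_eq_abs, abs_of_nonneg (hG0 j z)]
    exact hGm j z
  have key : ∀ (μ : Measure Z) [IsProbabilityMeasure μ] j,
      |∫ z, G j z ∂μ - ∑ i ∈ t, G j i * ∫ z, ψ i z ∂μ|
        ≤ m * (1 - ∑ i ∈ t, ∫ z, ψ i z ∂μ) + ε / 4 := by
    intro μ _ j
    have e1 : ∫ z, G j z ∂μ - ∑ i ∈ t, G j i * ∫ z, ψ i z ∂μ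
        = ∫ z, (G j z - ∑ i ∈ t, G j i * ψ i z) ∂μ := by
      rw [integral_sub (hGint μ j) (integrable_finsetSum t fun i _ => (hint μ i).const_mul _),
        integral_finsetSum t fun i _ => (hint μ i).const_mul _]
      simp_rw [integral_const_mul]
    have e2 : m * (1 - ∑ i ∈ t, ∫ z, ψ i z ∂μ) + ε / 4
        = ∫ z, (m * (1 - ∑ i ∈ t, ψ i z) + ε / 4) ∂μ := by
      have hI : Integrable (fun z => ∑ i ∈ t, ψ i z) μ :=
        integrable_finsetSum t fun i _ => hint μ i
      have hI' : Integrable (fun z => m * (1 - ∑ i ∈ t, ψ i z)) μ :=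
        ((integrable_const 1).sub hI).const_mul m
      rw [integral_add hI' (integrable_const _), integral_const_mul, integral_sub (integrable_const _) hI,
        integral_finsetSum t fun i _ => hint μ i]
      simp
    rw [e1, e2, ← Real.norm_eq_abs]
    have hI : Integrable (fun z => ∑ i ∈ t, ψ i z) μ :=
        integrable_finsetSum t fun i _ => hint μ i
    refine norm_integral_le_of_norm_le
      ((((integrable_const 1).sub hI).const_mul m).add (integrable_const _))
      (Eventually.of_forall fun z => ?_)
    have e3 : G j z - ∑ i ∈ t, G j i * ψ i z
        = G j z * (1 - ∑ i ∈ t, ψ i z) + ∑ i ∈ t, (G j z - G j i) * ψ i z := by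
      simp_rw [sub_mul, Finset.sum_sub_distrib, ← Finset.mul_sum]; ring
    rw [e3, Real.norm_eq_abs]
    refine (abs_add_le _ _).trans (add_le_add ?_ ?_)
    · have h0 : 0 ≤ 1 - ∑ i ∈ t, ψ i z := sub_nonneg.2 (hsum1 t z)
      rw [abs_mul, abs_of_nonneg (hG0 j z), abs_of_nonneg h0]
      exact mul_le_mul_of_nonneg_right (hGm j z) h0
    · calc |∑ i ∈ t, (G j z - G j i) * ψ i z| ≤ ∑ i ∈ t, |(G j z - G j i) * ψ i z| :=
            Finset.abs_sum_le_sum_abs _ _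
        _ ≤ ∑ i ∈ t, ε / 4 * ψ i z := by
            refine Finset.sum_le_sum fun i _ => ?_
            rw [abs_mul, abs_of_nonneg (hψ0 i z)]
            by_cases hz : f i z = 0
            · simp [hψ, hz]
            · exact mul_le_mul_of_nonneg_right
                (hUG i z (hf i (subset_tsupport _ hz)) j) (hψ0 i z)
        _ = ε / 4 * ∑ i ∈ t, ψ i z := by rw [Finset.mul_sum]
        _ ≤ ε / 4 * 1 := by gcongr; exact hsum1 t z
        _ = ε / 4 := mul_one _
  intro μ _ hμ j
  have k1 := key μ j
  have k2 := key P j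
  rw [integral_finsetSum t fun i _ => hint P i] at ht
  have hcard : (t.card : ℝ) * (ε / (8 * (m + 1)) / (t.card + 1)) ≤ ε / (8 * (m + 1)) := by
    rw [mul_div_left_comm]
    exact mul_le_of_le_one_right hpos.le ((div_le_one (by positivity)).2 (by linarith))
  have hd : ∑ i ∈ t, |∫ z, ψ i z ∂μ - ∫ z, ψ i z ∂P| ≤ ε / (8 * (m + 1)) := by
    refine (Finset.sum_le_card_nsmul t _ _ hμ).trans ?_
    rwa [nsmul_eq_mul]
  have hs : |∑ i ∈ t, ∫ z, ψ i z ∂μ - ∑ i ∈ t, ∫ z, ψ i z ∂P| ≤ ε / (8 * (m + 1)) := by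
    rw [← Finset.sum_sub_distrib]
    exact (Finset.abs_sum_le_sum_abs _ _).trans hd
  have hg : |∑ i ∈ t, G j i * ∫ z, ψ i z ∂μ - ∑ i ∈ t, G j i * ∫ z, ψ i z ∂P|
      ≤ m * (ε / (8 * (m + 1))) := by
    rw [← Finset.sum_sub_distrib]
    refine (Finset.abs_sum_le_sum_abs _ _).trans ?_
    refine le_trans ?_ (mul_le_mul_of_nonneg_left hd hm)
    rw [Finset.mul_sum]
    refine Finset.sum_le_sum fun i _ => ?_
    rw [← mul_sub, abs_mul, abs_of_nonneg (hG0 j i)]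
    exact mul_le_mul_of_nonneg_right (hGm j i) (abs_nonneg _)
  have hmε : m * (ε / (8 * (m + 1))) ≤ ε / 8 := by
    rw [mul_div_assoc', div_le_div_iff₀ (by positivity) (by norm_num)]
    nlinarith
  have h1 : m * (1 - ∑ i ∈ t, ∫ z, ψ i z ∂P) ≤ m * (ε / (8 * (m + 1))) :=
    mul_le_mul_of_nonneg_left (by linarith) hm
  have h2 : m * (1 - ∑ i ∈ t, ∫ z, ψ i z ∂μ) ≤ m * (2 * (ε / (8 * (m + 1)))) :=
    mul_le_mul_of_nonneg_left (by linarith [(abs_le.1 hs).1]) hm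
  have h3 := abs_le.1 k1
  have h4 := abs_le.1 k2
  have h5 := abs_le.1 hg
  rw [abs_le]
  constructor <;> linarith [h3.1, h3.2, h4.1, h4.2, h5.1, h5.2]

lemma integral_empiricalMeasure {Z : Type*} [MeasurableSpace Z] [MeasurableSingletonClass Z] {N : ℕ}
    (z : Fin N → Z) (g : Z → ℝ) :
    ∫ w, g w ∂(empiricalMeasure z) = (N : ℝ)⁻¹ * ∑ i, g (z i) := by
  rw [empiricalMeasure, integral_smul_measure, integral_finsetSum_measure]
  · simp
  · intro i _
    exact integrable_dirac (by simp)

lemma isProbabilityMeasure_empiricalMeasure {Z : Type*} [MeasurableSpace Z] {N : ℕ} (hN : 0 < N)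
    (z : Fin N → Z) : IsProbabilityMeasure (empiricalMeasure z) := by
  refine ⟨?_⟩
  simp only [empiricalMeasure, Measure.smul_apply, Measure.finsetSum_apply, measure_univ,
    Finset.sum_const, Finset.card_univ, Fintype.card_fin, smul_eq_mul, nsmul_eq_mul, mul_one]
  exact ENNReal.inv_mul_cancel (by exact_mod_cast hN.ne') (ENNReal.natCast_ne_top N)

/-- Chebyshev's inequality for the sample mean of a function with values in `[0, 1]`. -/
lemma pi_abs_mean_sub_ge_le {Z : Type*} [MeasurableSpace Z] (Q : Measure Z)
    [IsProbabilityMeasure Q] {ψ : Z → ℝ} (hψ : Measurable ψ) (h0 : ∀ z, 0 ≤ ψ z)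
    (h1 : ∀ z, ψ z ≤ 1) {N : ℕ} (hN : 0 < N) {η : ℝ} (hη : 0 < η) :
    Measure.pi (fun _ : Fin N => Q) {z | η ≤ |(N : ℝ)⁻¹ * ∑ i, ψ (z i) - ∫ w, ψ w ∂Q|}
      ≤ ENNReal.ofReal (1 / (N * η ^ 2)) := by
  have hN' : (0 : ℝ) < N := by exact_mod_cast hN
  have hL : MemLp ψ 2 Q := MemLp.of_bound hψ.aestronglyMeasurable 1
    (Eventually.of_forall fun z => by rw [Real.norm_eq_abs, abs_of_nonneg (h0 z)]; exact h1 z)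
  let X : (Fin N → Z) → ℝ := ∑ i, fun z => ψ (z i)
  have hcomp : ∀ i : Fin N, MemLp (fun z : Fin N → Z => ψ (z i)) 2 (Measure.pi fun _ => Q) :=
    fun i => hL.comp_measurePreserving (measurePreserving_eval (fun _ : Fin N => Q) i)
  have hX : MemLp X 2 (Measure.pi fun _ => Q) := memLp_finsetSum' _ fun i _ => hcomp i
  have hXi : ∀ z, X z = ∑ i, ψ (z i) := fun z => Finset.sum_apply _ _ _
  have hmean : ∫ z, X z ∂(Measure.pi fun _ => Q) = N * ∫ w, ψ w ∂Q := by
    simp_rw [hXi]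
    rw [integral_finsetSum _ fun i _ => (hcomp i).integrable (by norm_num)]
    have : ∀ i : Fin N, ∫ z, ψ (z i) ∂(Measure.pi fun _ : Fin N => Q) = ∫ w, ψ w ∂Q := by
      intro i
      rw [integral_comp_eval (μ := fun _ : Fin N => Q) (i := i) hψ.aestronglyMeasurable]
    simp [this]
  have hvar : variance X (Measure.pi fun _ => Q) ≤ N := by
    have h := variance_sum_pi (μ := fun _ : Fin N => Q) (X := fun _ => ψ) (fun _ => hL)
    have hb : variance ψ Q ≤ ((1 - 0) / 2) ^ 2 :=
      variance_le_sq_of_bounded (Eventually.of_forall fun z => ⟨h0 z, h1 z⟩) hψ.aemeasurable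
    change variance X _ = _ at h
    rw [h]
    simp only [Finset.sum_const, Finset.card_univ, Fintype.card_fin, nsmul_eq_mul]
    nlinarith
  have hc := meas_ge_le_variance_div_sq hX (c := N * η) (by positivity)
  refine (measure_mono ?_).trans (hc.trans (ENNReal.ofReal_le_ofReal ?_))
  · intro z hz
    simp only [Set.mem_ofPred_eq] at hz ⊢
    rw [hmean, hXi]
    have e : ∑ i, ψ (z i) - N * ∫ w, ψ w ∂Q
        = N * ((N : ℝ)⁻¹ * ∑ i, ψ (z i) - ∫ w, ψ w ∂Q) := by field_simp
    rw [e, abs_mul, abs_of_pos hN']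
    exact mul_le_mul_of_nonneg_left hz hN'.le
  · rw [div_le_div_iff₀ (by positivity) (by positivity)]
    have : (0:ℝ) < N * η ^ 2 := by positivity
    nlinarith

/-- Markov's inequality for the sample mean of a non-negative function. -/
lemma pi_mean_ge_le {Z : Type*} [MeasurableSpace Z] (Q : Measure Z)
    [IsProbabilityMeasure Q] {g : Z → ℝ} (hg : Measurable g) (h0 : ∀ z, 0 ≤ g z)
    {N : ℕ} (hN : 0 < N) {η : ℝ} (hη : 0 < η) :
    Measure.pi (fun _ : Fin N => Q) {z | η ≤ (N : ℝ)⁻¹ * ∑ i, g (z i)}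
      ≤ (∫⁻ w, ENNReal.ofReal (g w) ∂Q) / ENNReal.ofReal η := by
  have hm : ∀ i : Fin N, Measurable fun z : Fin N → Z => ENNReal.ofReal (g (z i)) :=
    fun i => (hg.comp (measurable_pi_apply i)).ennreal_ofReal
  have hint : ∫⁻ z, ENNReal.ofReal ((N : ℝ)⁻¹ * ∑ i, g (z i)) ∂(Measure.pi fun _ : Fin N => Q)
      = ∫⁻ w, ENNReal.ofReal (g w) ∂Q := by
    have e : ∀ z : Fin N → Z, ENNReal.ofReal ((N : ℝ)⁻¹ * ∑ i, g (z i))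
        = (N : ℝ≥0∞)⁻¹ * ∑ i, ENNReal.ofReal (g (z i)) := by
      intro z
      rw [ENNReal.ofReal_mul (by positivity), ENNReal.ofReal_sum_of_nonneg fun i _ => h0 _,
        ENNReal.ofReal_inv_of_pos (by exact_mod_cast hN), ENNReal.ofReal_natCast]
    simp_rw [e]
    rw [lintegral_const_mul _ (Finset.measurable_sum _ fun i _ => hm i),
      lintegral_finsetSum _ fun i _ => hm i]
    have : ∀ i : Fin N, ∫⁻ z, ENNReal.ofReal (g (z i)) ∂(Measure.pi fun _ : Fin N => Q)
        = ∫⁻ w, ENNReal.ofReal (g w) ∂Q := fun i =>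
      (measurePreserving_eval (fun _ : Fin N => Q) i).lintegral_comp hg.ennreal_ofReal
    simp only [this, Finset.sum_const, Finset.card_univ, Fintype.card_fin, nsmul_eq_mul]
    rw [← mul_assoc, ENNReal.inv_mul_cancel (by exact_mod_cast hN.ne')
      (ENNReal.natCast_ne_top N), one_mul]
  rw [← hint]
  refine (measure_mono fun z hz => ?_).trans
    (meas_ge_le_lintegral_div (ε := ENNReal.ofReal η) ?_ ?_ ENNReal.ofReal_ne_top)
  · exact ENNReal.ofReal_le_ofReal hz
  · exact ((Finset.measurable_sum _ fun i _ => hg.comp (measurable_pi_apply i)).const_mul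
      _).ennreal_ofReal.aemeasurable
  · simpa using hη

/-- Two probability measures on `ℝ` concentrated near the same point are Lévy–Prokhorov close. -/
lemma levyProkhorovDist_le_of_concentrated {μ ν : Measure ℝ} [IsProbabilityMeasure μ]
    [IsProbabilityMeasure ν] {v ε : ℝ} (hε : 0 < ε)
    (hμ : μ {t | ε / 2 ≤ |t - v|} ≤ ENNReal.ofReal ε)
    (hν : ν {t | ε / 2 ≤ |t - v|} ≤ ENNReal.ofReal ε) :
    levyProkhorovDist μ ν ≤ ε := by
  have key : ∀ (μ ν : Measure ℝ) [IsProbabilityMeasure μ] [IsProbabilityMeasure ν],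
      μ {t | ε / 2 ≤ |t - v|} ≤ ENNReal.ofReal ε → ν {t | ε / 2 ≤ |t - v|} ≤ ENNReal.ofReal ε →
      ∀ B : Set ℝ, μ B ≤ ν (Metric.thickening ε B) + ENNReal.ofReal ε := by
    intro μ ν _ _ hμ hν B
    by_cases hB : ∃ b ∈ B, |b - v| < ε / 2
    · obtain ⟨b, hb, hbv⟩ := hB
      calc μ B ≤ 1 := prob_le_one
        _ = ν Set.univ := measure_univ.symm
        _ ≤ ν (Metric.thickening ε B ∪ {t | ε / 2 ≤ |t - v|}) := by
          refine measure_mono fun t _ => ?_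
          by_cases ht : ε / 2 ≤ |t - v|
          · exact Or.inr ht
          · refine Or.inl (Metric.mem_thickening_iff.2 ⟨b, hb, ?_⟩)
            rw [Real.dist_eq]
            have h1 := abs_lt.1 (not_le.1 ht)
            have h2 := abs_lt.1 hbv
            rw [abs_lt]
            constructor <;> linarith [h1.1, h1.2, h2.1, h2.2]
        _ ≤ _ := (measure_union_le _ _).trans (by gcongr)
    · push Not at hB
      exact ((measure_mono hB).trans hμ).trans le_add_self
  have hed : levyProkhorovEDist μ ν ≤ ENNReal.ofReal ε := by
    refine sInf_le fun B _ => ?_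
    rw [ENNReal.toReal_ofReal hε.le]
    exact ⟨key μ ν hμ hν B, key ν μ hν hμ B⟩
  exact ENNReal.toReal_le_of_le_ofReal hε.le hed

/-- Integrals of finitely many bounded continuous functions depend continuously on the measure
for the Lévy–Prokhorov distance. -/
lemma exists_levyProkhorovDist_integral_close {Z : Type*} [MetricSpace Z] [MeasurableSpace Z]
    [BorelSpace Z] {ι : Type*} (t : Finset ι)
    (ψ : ι → Z →ᵇ ℝ) (P : ProbabilityMeasure Z) {η : ℝ} (hη : 0 < η) :
    ∃ δ : ℝ, 0 < δ ∧ ∀ Q : ProbabilityMeasure Z,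
      levyProkhorovDist (P : Measure Z) (Q : Measure Z) ≤ δ →
        ∀ i ∈ t, |∫ z, ψ i z ∂(Q : Measure Z) - ∫ z, ψ i z ∂(P : Measure Z)| < η := by
  have hcont : ∀ i ∈ t, ∀ᶠ Q : LevyProkhorov (ProbabilityMeasure Z)
      in 𝓝 (LevyProkhorov.ofMeasure P),
      |∫ z, ψ i z ∂(Q.toMeasure : Measure Z) - ∫ z, ψ i z ∂(P : Measure Z)| < η := by
    intro i _
    have h := (ProbabilityMeasure.tendsto_iff_forall_integral_tendsto.1
      ((LevyProkhorov.continuous_toMeasure_probabilityMeasure (Ω := Z)).tendsto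
        (LevyProkhorov.ofMeasure P)) (ψ i))
    exact (Metric.tendsto_nhds.1 h) η hη
  obtain ⟨δ, hδ, h⟩ := Metric.eventually_nhds_iff.1 ((Finset.eventually_all t).2 hcont)
  refine ⟨δ / 2, half_pos hδ, fun Q hQ i hi => ?_⟩
  refine h (y := LevyProkhorov.ofMeasure Q) ?_ i hi
  rw [dist_comm, LevyProkhorov.dist_probabilityMeasure_def]
  exact hQ.trans_lt (half_lt_self hδ)

/-- Uniform tail bound for the excess of a gauge over a level in a moment class. -/
lemma exists_lintegral_excess_le {Z : Type*} [MeasurableSpace Z] {φ : Z → ℝ} (hφ : Measurable φ)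
    (hφ0 : ∀ z, 0 ≤ φ z) {p κ : ℝ} (hp : 1 < p) {ε : ℝ} (hε : 0 < ε) :
    ∃ m : ℝ, 0 < m ∧ ∀ Q ∈ momentClass φ p κ,
      ∫⁻ z, ENNReal.ofReal (max (φ z - m) 0) ∂(Q : Measure Z) ≤ ENNReal.ofReal ε := by
  have hlim : Tendsto (fun m : ℝ => m ^ (-(p - 1)) * κ) atTop (𝓝 (0 * κ)) :=
    (tendsto_rpow_neg_atTop (by linarith)).mul_const κ
  rw [zero_mul] at hlim
  obtain ⟨m, hm, hm0⟩ := ((hlim.eventually (gt_mem_nhds hε)).and (eventually_gt_atTop 0)).exists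
  refine ⟨m, hm0, fun Q hQ => ?_⟩
  have hmp : 0 ≤ m ^ (-(p - 1)) := Real.rpow_nonneg hm0.le _
  have hpt : ∀ z, max (φ z - m) 0 ≤ m ^ (-(p - 1)) * φ z ^ p := by
    intro z
    refine max_le ?_ (mul_nonneg hmp (Real.rpow_nonneg (hφ0 z) _))
    rcases le_or_gt (φ z) m with h | h
    · exact (sub_nonpos.2 h).trans (mul_nonneg hmp (Real.rpow_nonneg (hφ0 z) _))
    · have hz : 0 < φ z := hm0.trans h
      have h1 : φ z ^ (-(p - 1)) ≤ m ^ (-(p - 1)) :=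
        Real.rpow_le_rpow_of_nonpos hm0 h.le (by linarith)
      calc φ z - m ≤ φ z := by linarith
        _ = φ z ^ (-(p - 1)) * φ z ^ p := by
          rw [← Real.rpow_add hz]; simp
        _ ≤ _ := mul_le_mul_of_nonneg_right h1 (Real.rpow_nonneg hz.le _)
  calc ∫⁻ z, ENNReal.ofReal (max (φ z - m) 0) ∂(Q : Measure Z)
      ≤ ∫⁻ z, ENNReal.ofReal (m ^ (-(p - 1))) * ENNReal.ofReal (φ z ^ p) ∂(Q : Measure Z) := by
        refine lintegral_mono fun z => ?_
        rw [← ENNReal.ofReal_mul hmp]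
        exact ENNReal.ofReal_le_ofReal (hpt z)
    _ = ENNReal.ofReal (m ^ (-(p - 1))) * ∫⁻ z, ENNReal.ofReal (φ z ^ p) ∂(Q : Measure Z) :=
        lintegral_const_mul _ (hφ.pow_const p).ennreal_ofReal
    _ ≤ ENNReal.ofReal (m ^ (-(p - 1))) * ENNReal.ofReal κ := by gcongr; exact hQ
    _ = ENNReal.ofReal (m ^ (-(p - 1)) * κ) := (ENNReal.ofReal_mul hmp).symm
    _ ≤ ENNReal.ofReal ε := ENNReal.ofReal_le_ofReal hm.le

/-- A map on a metric space that is uniformly continuous on compact sets is continuous. -/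
lemma continuous_of_uniform_on_compacts {X W : Type*} [PseudoMetricSpace X] [PseudoMetricSpace W]
    (u : X → W) (h : ∀ K : Set X, IsCompact K → ∀ ε : ℝ, 0 < ε → ∃ η : ℝ, 0 < η ∧
      ∀ x ∈ K, ∀ x' ∈ K, dist x' x < η → dist (u x') (u x) < ε) : Continuous u := by
  refine continuous_iff_continuousAt.2 fun x => tendsto_of_seq_tendsto fun s hs => ?_
  refine Metric.tendsto_nhds.2 fun ε hε => ?_
  obtain ⟨η, hη, hK⟩ := h _ hs.isCompact_insert_range ε hε
  filter_upwards [Metric.tendsto_nhds.1 hs η hη] with n hn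
  exact hK x (Set.mem_insert _ _) (s n) (Set.mem_insert_of_mem _ ⟨n, rfl⟩) hn

section RKHS

lemma rkhs_apply_eq_inner {X H : Type*} [NormedAddCommGroup H] [InnerProductSpace ℝ H]
    [CompleteSpace H] [RKHS ℝ H X ℝ] (f : H) (x : X) :
    f x = ⟪f, RKHS.kerFun H x (1 : ℝ)⟫ := by
  rw [RKHS.inner_kerFun]; simp

variable {X : Type*} [PseudoMetricSpace X] {H : Type*} [NormedAddCommGroup H]
  [InnerProductSpace ℝ H] [CompleteSpace H] [RKHS ℝ H X ℝ]

/-- If the kernel sections depend continuously on the point and `c` is continuous, the losses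
`z ↦ c (z, f z.1)` over a norm-bounded class of functions are equicontinuous. -/
lemma equicontinuous_loss {Y : Set ℝ} (hY : IsClosed Y)
    (hk : Continuous fun x : X => RKHS.kerFun H x (1 : ℝ)) {F : Set H}
    (hFY : ∀ f ∈ F, ∀ x : X, f x ∈ Y) {β : ℝ} (hFβ : ∀ f ∈ F, ‖f‖ ≤ β)
    {c : X × Y → ℝ → ℝ} (hc : ContinuousOn (Function.uncurry c) (Set.univ ×ˢ Y)) :
    Equicontinuous fun (f : F) (z : X × Y) => c z ((f : H) z.1) := by
  intro z₀
  rw [Metric.equicontinuousAt_iff_right]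
  intro ε hε
  let C : (X × Y) × Y → ℝ := fun w => c w.1 w.2
  have hC : Continuous C :=
    hc.comp_continuous (f := fun w : (X × Y) × Y => (w.1, (w.2 : ℝ))) (by fun_prop)
      fun w => ⟨Set.mem_univ _, w.2.2⟩
  let R := β * ‖RKHS.kerFun H z₀.1 (1 : ℝ)‖
  have hKc : IsCompact ({z₀} ×ˢ ((↑) ⁻¹' Metric.closedBall (0 : ℝ) R) : Set ((X × Y) × Y)) :=
    isCompact_singleton.prod
      (hY.isClosedEmbedding_subtypeVal.isCompact_preimage (isCompact_closedBall 0 R))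
  obtain ⟨r, hr, hCr⟩ := Metric.mem_uniformity_dist.1
    (hKc.uniformContinuousAt_of_continuousAt C (fun a _ => hC.continuousAt)
      (Metric.dist_mem_uniformity hε))
  have hdist : Tendsto (fun z : X × Y =>
      β * ‖RKHS.kerFun H z.1 (1 : ℝ) - RKHS.kerFun H z₀.1 (1 : ℝ)‖) (𝓝 z₀) (𝓝 0) := by
    have h : Continuous fun z : X × Y =>
        β * ‖RKHS.kerFun H z.1 (1 : ℝ) - RKHS.kerFun H z₀.1 (1 : ℝ)‖ :=
      ((((hk.comp continuous_fst).sub continuous_const).norm).const_mul β)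
    simpa using h.tendsto z₀
  filter_upwards [Metric.ball_mem_nhds z₀ hr, hdist.eventually (gt_mem_nhds hr)] with z hz hz' f
  have hb : |(f : H) z₀.1| ≤ R := by
    rw [rkhs_apply_eq_inner]
    exact (abs_real_inner_le_norm _ _).trans
      (mul_le_mul_of_nonneg_right (hFβ f f.2) (norm_nonneg _))
  have hd : |(f : H) z.1 - (f : H) z₀.1| < r := by
    rw [rkhs_apply_eq_inner, rkhs_apply_eq_inner, ← inner_sub_right]
    exact ((abs_real_inner_le_norm _ _).trans
      (mul_le_mul_of_nonneg_right (hFβ f f.2) (norm_nonneg _))).trans_lt hz'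
  have := hCr (a := (z₀, ⟨(f : H) z₀.1, hFY f f.2 _⟩)) (b := (z, ⟨(f : H) z.1, hFY f f.2 _⟩))
    (by
      rw [Prod.dist_eq, max_lt_iff, dist_comm, dist_comm (Subtype.mk _ _)]
      exact ⟨hz, by rw [Subtype.dist_eq, Real.dist_eq]; exact hd⟩)
    ⟨rfl, by simpa [Real.dist_eq] using hb⟩
  exact this

end RKHS

lemma equicontinuous_min_const {Z ι : Type*} [TopologicalSpace Z] {G : ι → Z → ℝ}
    (hG : Equicontinuous G) (m : ℝ) : Equicontinuous fun i z => min (G i z) m := by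
  intro z
  rw [Metric.equicontinuousAt_iff_right]
  intro ε hε
  filter_upwards [Metric.equicontinuousAt_iff_right.1 (hG z) ε hε] with w hw i
  refine lt_of_le_of_lt ?_ (hw i)
  rw [Real.dist_eq, Real.dist_eq]
  simpa using abs_min_sub_min_le_max (G i z) m (G i w) m

/-- The penalized empirical optimal value is measurable. -/
lemma measurable_iInf_mean {Z : Type*} [TopologicalSpace Z] [SecondCountableTopology Z]
    [MeasurableSpace Z] [BorelSpace Z] {ι : Type*} [Nonempty ι] {G : ι → Z → ℝ}
    (hG : ∀ i, Continuous (G i)) (hG0 : ∀ i z, 0 ≤ G i z) {pen : ι → ℝ} (hpen : ∀ i, 0 ≤ pen i)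
    (N : ℕ) :
    Measurable fun z : Fin N → Z => ⨅ i, ((N : ℝ)⁻¹ * ∑ j, G i (z j) + pen i) := by
  refine (upperSemicontinuous_ciInf (fun z => ⟨0, ?_⟩) fun i => ?_).measurable
  · rintro _ ⟨i, rfl⟩
    have := Finset.sum_nonneg fun (j : Fin N) (_ : j ∈ Finset.univ) => hG0 i (z j)
    have := hpen i
    positivity
  · have : Continuous fun z : Fin N → Z => (N : ℝ)⁻¹ * ∑ j, G i (z j) + pen i := by
      have := hG i
      fun_prop
    exact this.upperSemicontinuous

lemma abs_ciInf_sub_ciInf_le {ι : Type*} [Nonempty ι] {a b : ι → ℝ} {r : ℝ}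
    (ha : ∀ i, 0 ≤ a i) (hb : ∀ i, 0 ≤ b i) (h : ∀ i, |a i - b i| ≤ r) :
    |(⨅ i, a i) - ⨅ i, b i| ≤ r := by
  have key : ∀ a b : ι → ℝ, (∀ i, 0 ≤ a i) → (∀ i, |a i - b i| ≤ r) →
      (⨅ i, a i) - r ≤ ⨅ i, b i := by
    intro a b ha h
    refine le_ciInf fun i => ?_
    have h1 : ⨅ i, a i ≤ a i := ciInf_le ⟨0, by rintro _ ⟨i, rfl⟩; exact ha i⟩ i
    linarith [(abs_le.1 (h i)).2]
  rw [abs_le]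
  have h1 := key a b ha h
  have h2 := key b a hb fun i => by rw [abs_sub_comm]; exact h i
  constructor <;> linarith

/-- Uniformly over a Lévy–Prokhorov neighbourhood of `P` in a moment class, the penalized
empirical optimal values concentrate around one deterministic value. -/
lemma exists_concentration {Z : Type*} [MetricSpace Z] [SecondCountableTopology Z]
    [MeasurableSpace Z] [BorelSpace Z] {ι : Type*} [Nonempty ι] {G : ι → Z → ℝ}
    (hG : Equicontinuous G) (hG0 : ∀ i z, 0 ≤ G i z) {φ : Z → ℝ} (hφ : Continuous φ)
    (hGφ : ∀ i z, G i z ≤ φ z) {p κ : ℝ} (hp : 1 < p)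
    (P : ProbabilityMeasure Z) {ε : ℝ} (hε : 0 < ε) :
    ∃ (v δ : ℝ) (N₀ : ℕ), 0 < δ ∧ ∀ Q ∈ momentClass φ p κ,
      levyProkhorovDist (P : Measure Z) (Q : Measure Z) ≤ δ → ∀ N, N₀ ≤ N →
        ∀ pen : ι → ℝ, (∀ i, 0 ≤ pen i) → (∀ i, pen i ≤ ε / 6) →
          Measure.pi (fun _ : Fin N => (Q : Measure Z))
            {z | ε / 2 ≤ |(⨅ i, ((N : ℝ)⁻¹ * ∑ j, G i (z j) + pen i)) - v|}
            ≤ ENNReal.ofReal ε := by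
  obtain ⟨i₀⟩ := ‹Nonempty ι›
  have : Nonempty ι := ⟨i₀⟩
  have hφ0 : ∀ z, 0 ≤ φ z := fun z => (hG0 i₀ z).trans (hGφ i₀ z)
  obtain ⟨m, hm, htail⟩ := exists_lintegral_excess_le (κ := κ) hφ.measurable hφ0 hp
    (ε := ε / 8 * (ε / 2)) (by positivity)
  obtain ⟨S, t, ψ, η, hη, hψ0, hψ1, htest⟩ := exists_finite_test_functions
    (fun i z => min (G i z) m) (equicontinuous_min_const hG m) hm.le
    (fun i z => le_min (hG0 i z) hm.le) (fun i z => min_le_right _ _) (P : Measure Z)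
    (ε := ε / 8) (by positivity)
  obtain ⟨δ, hδ, hclose⟩ := exists_levyProkhorovDist_integral_close t ψ P (half_pos hη)
  have hlimN : Tendsto (fun N : ℕ => (t.card : ℝ) * (1 / ((N : ℝ) * (η / 2) ^ 2))) atTop
      (𝓝 ((t.card : ℝ) * 0)) := by
    refine Tendsto.const_mul _ ?_
    refine tendsto_const_nhds.div_atTop ?_
    exact tendsto_natCast_atTop_atTop.atTop_mul_const (by positivity)
  rw [mul_zero] at hlimN
  obtain ⟨N₁, hN₁⟩ := eventually_atTop.1 (hlimN.eventually (gt_mem_nhds (half_pos hε)))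
  refine ⟨⨅ i, ∫ z, min (G i z) m ∂(P : Measure Z), δ, max N₁ 1, hδ, ?_⟩
  intro Q hQ hPQ N hN pen hpen0 hpen
  have hN0 : 0 < N := (le_max_right N₁ 1).trans hN
  let A : Set (Fin N → Z) := {z | ε / 8 ≤ (N : ℝ)⁻¹ * ∑ j, max (φ (z j) - m) 0}
  let B : S → Set (Fin N → Z) := fun i =>
    {z | η / 2 ≤ |(N : ℝ)⁻¹ * ∑ j, ψ i (z j) - ∫ w, ψ i w ∂(Q : Measure Z)|}
  have hsub : {z : Fin N → Z | ε / 2 ≤ |(⨅ i, ((N : ℝ)⁻¹ * ∑ j, G i (z j) + pen i))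
      - ⨅ i, ∫ z, min (G i z) m ∂(P : Measure Z)|} ⊆ A ∪ ⋃ i ∈ t, B i := by
    intro z hz
    by_contra hcon
    rw [Set.mem_union, not_or, Set.mem_iUnion₂] at hcon
    push Not at hcon
    obtain ⟨hA, hB⟩ := hcon
    have hA' : (N : ℝ)⁻¹ * ∑ j, max (φ (z j) - m) 0 < ε / 8 := not_le.1 hA
    have := isProbabilityMeasure_empiricalMeasure hN0 z
    have hemp := htest (empiricalMeasure z) fun i hi => by
      have h1 : |(N : ℝ)⁻¹ * ∑ j, ψ i (z j) - ∫ w, ψ i w ∂(Q : Measure Z)| < η / 2 :=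
        not_le.1 (hB i hi)
      have h2 := hclose Q hPQ i hi
      rw [integral_empiricalMeasure]
      refine (abs_sub_le _ (∫ w, ψ i w ∂(Q : Measure Z)) _).trans ?_
      linarith
    simp_rw [integral_empiricalMeasure] at hemp
    have hbound : ∀ i, |((N : ℝ)⁻¹ * ∑ j, G i (z j) + pen i)
        - ∫ z, min (G i z) m ∂(P : Measure Z)| ≤ 5 * ε / 12 := by
      intro i
      have hlo : (N : ℝ)⁻¹ * ∑ j, min (G i (z j)) m ≤ (N : ℝ)⁻¹ * ∑ j, G i (z j) := by
        gcongr with j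
        exact min_le_left _ _
      have hhi : (N : ℝ)⁻¹ * ∑ j, G i (z j) ≤ (N : ℝ)⁻¹ * ∑ j, min (G i (z j)) m
          + (N : ℝ)⁻¹ * ∑ j, max (φ (z j) - m) 0 := by
        rw [← mul_add, ← Finset.sum_add_distrib]
        gcongr with j
        rcases le_total (G i (z j)) m with h | h
        · rw [min_eq_left h]; linarith [le_max_right (φ (z j) - m) 0]
        · rw [min_eq_right h]; linarith [le_max_left (φ (z j) - m) 0, hGφ i (z j)]
      have h1 := abs_le.1 (hemp i)
      have h2 := hpen i
      have h3 := hpen0 i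
      rw [abs_le]
      constructor <;> linarith [h1.1, h1.2]
    have hfin := abs_ciInf_sub_ciInf_le
      (fun i => add_nonneg (mul_nonneg (inv_nonneg.2 N.cast_nonneg)
        (Finset.sum_nonneg fun j _ => hG0 i (z j))) (hpen0 i))
      (fun i => integral_nonneg fun z => le_min (hG0 i z) hm.le) hbound
    have hz' := hfin.trans' (show ε / 2 ≤ _ from hz)
    linarith
  have hAle : Measure.pi (fun _ : Fin N => (Q : Measure Z)) A ≤ ENNReal.ofReal (ε / 2) := by
    refine (pi_mean_ge_le (Q : Measure Z) (g := fun w => max (φ w - m) 0)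
      ((hφ.measurable.sub_const m).max measurable_const) (fun z => le_max_right _ _) hN0
      (by positivity : 0 < ε / 8)).trans ?_
    refine ENNReal.div_le_of_le_mul ?_
    rw [← ENNReal.ofReal_mul (by positivity), mul_comm (ε / 2)]
    exact htail Q hQ
  have hBle : Measure.pi (fun _ : Fin N => (Q : Measure Z)) (⋃ i ∈ t, B i)
      ≤ ENNReal.ofReal (ε / 2) := by
    refine (measure_biUnion_finset_le t B).trans ?_
    refine (Finset.sum_le_sum fun i _ => pi_abs_mean_sub_ge_le (Q : Measure Z)
      (ψ i).continuous.measurable (hψ0 i) (hψ1 i) hN0 (half_pos hη)).trans ?_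
    rw [Finset.sum_const, ← ENNReal.ofReal_nsmul, nsmul_eq_mul]
    exact ENNReal.ofReal_le_ofReal (hN₁ N ((le_max_left _ _).trans hN)).le
  calc _ ≤ _ := measure_mono hsub
    _ ≤ ENNReal.ofReal (ε / 2) + ENNReal.ofReal (ε / 2) :=
      (measure_union_le _ _).trans (add_le_add hAle hBle)
    _ = ENNReal.ofReal ε := by
      rw [← ENNReal.ofReal_add (by positivity) (by positivity), add_halves]

end KernelLearning

theorem mainTheorem2
    {E : Type*} [NormedAddCommGroup E] [NormedSpace ℝ E] [SecondCountableTopology E]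
    [MeasurableSpace E] [BorelSpace E]
    (X : Set E) (Y : Set ℝ) (hY : IsClosed Y)
    {H : Type*} [NormedAddCommGroup H] [InnerProductSpace ℝ H] [CompleteSpace H] [RKHS ℝ H X ℝ]
    (F : Set H) (hF : F.Nonempty) (hFY : ∀ f ∈ F, ∀ x : X, f x ∈ Y)
    (c : X × Y → ℝ → ℝ) (hc_nonneg : ∀ f ∈ F, ∀ z : X × Y, 0 ≤ c z (f z.1))
    -- equicontinuity of the kernel sections on projections of compact sets
    (hker : ∀ K : Set (X × Y), IsCompact K → ∀ ε : ℝ, 0 < ε → ∃ η : ℝ, 0 < η ∧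
      ∀ x ∈ Prod.fst '' K, ∀ x' ∈ Prod.fst '' K, ‖(x' : E) - (x : E)‖ < η →
        ‖RKHS.kerFun H x' (1 : ℝ) - RKHS.kerFun H x (1 : ℝ)‖ < ε)
    -- boundedness of the feasible set
    (β : ℝ) (hβ : 0 < β) (hFβ : ∀ f ∈ F, ‖f‖ ≤ β)
    -- growth condition with a coercive gauge function
    (φ : X × Y → ℝ) (hφ : KernelLearning.IsGauge φ)
    (hgrowth : ∀ f ∈ F, ∀ z : X × Y, c z (f z.1) ≤ φ z)
    (hcoer : Tendsto φ (comap (fun z : X × Y => ‖((z.1 : E), (z.2 : ℝ))‖) atTop) atTop)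
    -- continuity of the cost on `Z × Y`
    (hc_cont : ContinuousOn (Function.uncurry c) (Set.univ ×ˢ Y))
    (p κ : ℝ) (hp : 1 < p) (hκ : 0 ≤ κ)
    (lam : ℕ → ℝ) (hlam_pos : ∀ N, 0 < lam N) (hlam : Tendsto lam atTop (𝓝 0)) :
    (∀ N, Measurable (KernelLearning.empOptValue c F (lam N) N)) ∧
    ∀ M : Set (ProbabilityMeasure (X × Y)), M ⊆ KernelLearning.momentClass φ p κ →
      ∀ P ∈ KernelLearning.momentClass φ p κ, ∀ ε : ℝ, 0 < ε →
        ∃ δ : ℝ, 0 < δ ∧ ∃ N₀ : ℕ,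
          (∀ N, N₀ ≤ N → lam N ≤ ε / (6 * β ^ 2)) ∧
          ∀ Q ∈ M, KernelLearning.dPhi φ P Q ≤ δ → ∀ N, N₀ ≤ N →
            levyProkhorovDist
              (KernelLearning.sampleLaw P (KernelLearning.empOptValue c F (lam N) N))
              (KernelLearning.sampleLaw Q (KernelLearning.empOptValue c F (lam N) N)) ≤ ε := by
  have hYne : ∀ x : X, Y.Nonempty := fun x => hF.elim fun f hf => ⟨f x, hFY f hf x⟩
  have hk : Continuous fun x : X => RKHS.kerFun H x (1 : ℝ) := by
    refine KernelLearning.continuous_of_uniform_on_compacts _ fun K hK ε hε => ?_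
    rcases K.eq_empty_or_nonempty with rfl | ⟨x₀, -⟩
    · exact ⟨1, one_pos, by simp⟩
    obtain ⟨y, hy⟩ := hYne x₀
    obtain ⟨η, hη, h⟩ := hker (K ×ˢ {⟨y, hy⟩}) (hK.prod isCompact_singleton) ε hε
    refine ⟨η, hη, fun x hx x' hx' hxx' => ?_⟩
    rw [dist_eq_norm]
    refine h x ⟨(x, ⟨y, hy⟩), ⟨hx, rfl⟩, rfl⟩ x' ⟨(x', ⟨y, hy⟩), ⟨hx', rfl⟩, rfl⟩ ?_
    rwa [Subtype.dist_eq, dist_eq_norm] at hxx'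
  have hG := KernelLearning.equicontinuous_loss hY hk hFY hFβ hc_cont
  have : Nonempty F := hF.to_subtype
  have hval : ∀ N, KernelLearning.empOptValue c F (lam N) N = fun z : Fin N → X × Y =>
      ⨅ f : F, ((N : ℝ)⁻¹ * ∑ j, c (z j) ((f : H) (z j).1) + lam N * ‖(f : H)‖ ^ 2) := by
    intro N
    funext z
    simp only [KernelLearning.empOptValue, KernelLearning.optValue, KernelLearning.regRisk,
      KernelLearning.integral_empiricalMeasure]
  have hpen0 : ∀ N (f : F), 0 ≤ lam N * ‖(f : H)‖ ^ 2 := fun N f =>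
    mul_nonneg (hlam_pos N).le (sq_nonneg _)
  have hmeas : ∀ N, Measurable (KernelLearning.empOptValue c F (lam N) N) := by
    intro N
    rw [hval]
    exact KernelLearning.measurable_iInf_mean (fun f => hG.continuous f)
      (fun f z => hc_nonneg f f.2 z) (hpen0 N) N
  refine ⟨hmeas, fun M hM P hP ε hε => ?_⟩
  obtain ⟨v, δ, N₁, hδ, hconc⟩ := KernelLearning.exists_concentration (κ := κ) hG
    (fun f z => hc_nonneg f f.2 z) hφ.continuous (fun f z => hgrowth f f.2 z) hp P hε
  obtain ⟨N₂, hN₂⟩ := eventually_atTop.1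
    (hlam.eventually (ge_mem_nhds (show 0 < ε / (6 * β ^ 2) by positivity)))
  refine ⟨δ, hδ, max N₁ N₂, fun N hN => hN₂ N ((le_max_right _ _).trans hN), ?_⟩
  intro Q hQ hPQ N hN
  have hpen : ∀ f : F, lam N * ‖(f : H)‖ ^ 2 ≤ ε / 6 := by
    intro f
    calc lam N * ‖(f : H)‖ ^ 2 ≤ ε / (6 * β ^ 2) * β ^ 2 := by
          gcongr
          · exact hN₂ N ((le_max_right _ _).trans hN)
          · exact hFβ f f.2
      _ = ε / 6 := by field_simp
  have hlaw : ∀ Q ∈ KernelLearning.momentClass φ p κ,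
      levyProkhorovDist (P : Measure (X × Y)) (Q : Measure (X × Y)) ≤ δ →
        KernelLearning.sampleLaw Q (KernelLearning.empOptValue c F (lam N) N)
          {s | ε / 2 ≤ |s - v|} ≤ ENNReal.ofReal ε := by
    intro Q hQ hPQ
    rw [KernelLearning.sampleLaw, Measure.map_apply (hmeas N)
      (measurableSet_le measurable_const (by fun_prop)), hval]
    exact hconc Q hQ hPQ N ((le_max_left _ _).trans hN) _ (hpen0 N) hpen
  have hprob : ∀ Q : ProbabilityMeasure (X × Y), IsProbabilityMeasure
      (KernelLearning.sampleLaw Q (KernelLearning.empOptValue c F (lam N) N)) := fun Q =>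
    Measure.isProbabilityMeasure_map (hmeas N).aemeasurable
  have := hprob P
  have := hprob Q
  refine KernelLearning.levyProkhorovDist_le_of_concentrated hε
    (hlaw P hP ?_) (hlaw Q (hM hQ) ?_)
  · rw [levyProkhorovDist_self]; exact hδ.le
  · exact le_trans (le_add_of_nonneg_right (abs_nonneg _)) hPQ
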